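/- Let $F$ be a perfect field (for instance $\mathbb{Q}$, $\mathbb{C}$ or $\mathbb{Z}/\mu\mathbb{Z}$, $\mu$ prime) with algebraic closure $\overline{F}$. Let $P,Q\in F[x,y]$ have no non-constant common factor, with degrees $p=\deg_y P\ge q=\deg_y Q$, and such that the leading coefficients of $P$ and $Q$ with respect to $y$ are coprime in $F[x]$. If $q<p$, assume moreover that $Q(\alpha,y)$ is not identically zero, for every $\alpha\in\overline{F}$ (that is, $Q$ is nonzero and has no non-constant factor in $F[x]$). *Subresultants.* For an $m\times n$ matrix $M$ with $1\le m\le n$, the polynomial determinant of $M$ is $\sum_{j=m}^{n}\det(M_j)\,y^{n-j}$, where $M_j$ consists of the first $m-1$ columns and the $j$-th column of $M$. For $0\le i\le q$, let $\mathrm{Sylv}_i(P,Q)$ be the $(p+q-2i)\times(p+q-i)$ matrix obtained from the Sylvester matrix of $P,Q$ with respect to $y$ (with rows $y^{q-1}P,\dots,P,y^{p-1}Q,\dots,Q$ in the basis $y^{p+q-1},\dots,y,1$) by deleting the last $i$ rows of coefficients of $P$, the last $i$ rows of coefficients of $Q$ and the last $i$ columns. Let $\mathrm{Sres}_{i}\in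 F(x)[y]$ be the polynomial determinant of $\mathrm{Sylv}_i(P,Q)$, except that for $i=q=p$ one sets $\mathrm{Sres}_{q}=b_q^{-1}Q$, with $b_q$ the leading coefficient of $Q$ in $y$. Let $\mathrm{sres}_{i}\in F[x]$ be the coefficient of $y^i$ in $\mathrm{Sres}_{i}$ (equal to $1$ for $i=q=p$); $\mathrm{sres}_{0}$ is the resultant $\mathrm{Res}_y(P,Q)$. *Triangular decomposition.* Let $G_0$ be the squarefree part of $\mathrm{Res}_y(P,Q)$ (the product of its distinct monic irreducible factors) and, for $i=1,\dots,q$, let $G_i=\gcd(G_{i-1},\mathrm{sres}_{i})$, $A_i=G_{i-1}/G_i$ and $B_i=\mathrm{Sres}_{i}$. The triangular decomposition of $\{P,Q\}$ is the family $\{(A_i,B_i)\}_{i\in\mathcal I}$ with $\mathcal I=\{i : 1\le i\le q,\ \deg_x A_i>0\}$, and its degree is $\sum_{i\in\mathcal I}\deg_x(A_i)\,\deg_y(B_i)$. *Claim.* The set $V$ of solutions $(\alpha,\beta)\in\overline{F}^2$ of $P=Q=0$ is finite, and $$\sum_{i\in\mathcal I}\deg_x(A_i)\,\deg_y(B_i)=\sum_{(\alpha,\beta)\in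 V}\operatorname{mult}\bigl(\beta,\gcd(P(\alpha,y),Q(\alpha,y))\bigr),$$ where $\operatorname{mult}(\beta,f)$ is the multiplicity of $\beta$ as a root of $f\in\overline{F}[y]$. -/

import Mathlib

open Polynomial

noncomputable section

namespace TriDec

section Subresultants

variable {D : Type*} [CommRing D]

/-- The polynomial determinant of an `m × n` matrix `M` with `m ≤ n`: the sum, over the columns `j`
from the `m`-th to the last, of `det M_j * y ^ (n - j)`, where `M_j` consists of the first `m - 1`
columns of `M` and the column `j`. (Columns are numbered from `0` in the code.) -/
def polynomialDet {m n : ℕ} (h : m ≤ n) (M : Matrix (Fin m) (Fin n) D) : D[X] :=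
  ∑ j ∈ Finset.univ.filter (fun j : Fin n => m ≤ (j : ℕ) + 1),
    C (M.submatrix id (fun c : Fin m => if (c : ℕ) + 1 < m then Fin.castLE h c else j)).det *
      X ^ (n - 1 - (j : ℕ))

/-- With `p = deg P` and `q = deg Q`, the matrix `Sylv_i(P, Q)` for `i ≤ min(p, q)`: its rows are
`y^(q-1) P, …, y^i P, y^(p-1) Q, …, y^i Q` and its columns are the coefficients of
`y^(p+q-1), …, y^i`. This is the Sylvester matrix (the case `i = 0`) with the `i` last rows of `P`,
the `i` last rows of `Q` and the `i` last columns deleted. -/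
def sylv (P Q : D[X]) (i : ℕ) :
    Matrix (Fin (P.natDegree + Q.natDegree - 2 * i)) (Fin (P.natDegree + Q.natDegree - i)) D :=
  Matrix.of fun r c =>
    (if (r : ℕ) < Q.natDegree - i then X ^ (Q.natDegree - 1 - (r : ℕ)) * P
      else X ^ (P.natDegree - 1 - ((r : ℕ) - (Q.natDegree - i))) * Q).coeff
        (P.natDegree + Q.natDegree - 1 - (c : ℕ))

/-- The polynomial determinant of `Sylv_i(P, Q)`. -/
def sylvDet (P Q : D[X]) (i : ℕ) : D[X] :=
  polynomialDet (by omega) (sylv P Q i)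

/-- The `i`-th polynomial subresultant `Sres_i(P, Q)`, for `deg Q ≤ deg P` and `i ≤ deg Q`: the
polynomial determinant of `Sylv_i(P, Q)`, except that it is `b_q⁻¹ Q` if `i = deg Q = deg P`, with
`b_q` the leading coefficient of `Q`. As `b_q⁻¹` need not lie in `D`, it is taken with coefficients
in the fraction field of `D`. -/
def subresultant [IsDomain D] (P Q : D[X]) (i : ℕ) : (FractionRing D)[X] :=
  if i = Q.natDegree ∧ Q.natDegree = P.natDegree then
    C (algebraMap D (FractionRing D) Q.leadingCoeff)⁻¹ * Q.map (algebraMap D (FractionRing D))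
  else (sylvDet P Q i).map (algebraMap D (FractionRing D))

/-- The `i`-th principal subresultant coefficient `sres_i(P, Q)`, that is, the coefficient of `y^i`
in `Sres_i(P, Q)`; it lies in `D` (it is `1` if `i = deg Q = deg P`). -/
def principalSubresultant (P Q : D[X]) (i : ℕ) : D :=
  if i = Q.natDegree ∧ Q.natDegree = P.natDegree then 1 else (sylvDet P Q i).coeff i

theorem algebraMap_principalSubresultant [IsDomain D] (P Q : D[X]) (hQ : Q ≠ 0) (i : ℕ) :
    algebraMap D (FractionRing D) (principalSubresultant P Q i) =
      (subresultant P Q i).coeff i := by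
  unfold principalSubresultant subresultant
  split_ifs with h
  · obtain ⟨rfl, -⟩ := h
    rw [coeff_C_mul, coeff_map, coeff_natDegree, map_one, inv_mul_cancel₀]
    simpa using hQ
  · rw [coeff_map]

end Subresultants

section Decomposition

variable {F : Type*} [Field F]

/- Bivariate polynomials are elements of `F[X][X]`: the inner variable is `x`, the outer is `y`. -/

open scoped Classical in
/-- The sequence `G_0 = ` squarefree part of `Res_y(P, Q) = sres_{y,0}(P, Q)`,
`G_i = gcd(G_{i-1}, sres_{y,i}(P, Q))`. -/
def G (P Q : F[X][X]) : ℕ → F[X]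
  | 0 => UniqueFactorizationMonoid.radical (principalSubresultant P Q 0)
  | i + 1 => EuclideanDomain.gcd (G P Q i) (principalSubresultant P Q (i + 1))

/-- `A_i = G_{i-1} / G_i` (an exact division), for `i ≥ 1`. -/
def A (P Q : F[X][X]) (i : ℕ) : F[X] := G P Q (i - 1) / G P Q i

/-- `B_i = Sres_{y,i}(P, Q)`. -/
def B (P Q : F[X][X]) (i : ℕ) : (FractionRing F[X])[X] := subresultant P Q i

/-- The index set of the triangular decomposition `{(A_i, B_i)}` of `{P, Q}`: the `i` with
`1 ≤ i ≤ deg_y Q` and `deg_x A_i > 0`. -/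
def indexSet (P Q : F[X][X]) : Finset ℕ :=
  {i ∈ Finset.Icc 1 Q.natDegree | 0 < (A P Q i).natDegree}

/-- The degree of the triangular decomposition of `{P, Q}`. -/
def degree (P Q : F[X][X]) : ℕ :=
  ∑ i ∈ indexSet P Q, (A P Q i).natDegree * (B P Q i).natDegree

/-- `P(α, y)`, for `α` in the algebraic closure of `F`. -/
def specialize (α : AlgebraicClosure F) (P : F[X][X]) : (AlgebraicClosure F)[X] :=
  P.map (aeval α : F[X] →ₐ[F] AlgebraicClosure F).toRingHom

/-- The solutions of the system `{P, Q}` in the algebraic closure of `F`. -/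
def solutions (P Q : F[X][X]) : Set (AlgebraicClosure F × AlgebraicClosure F) :=
  {z | (specialize z.1 P).eval z.2 = 0 ∧ (specialize z.1 Q).eval z.2 = 0}

open scoped Classical in
/-- The multiplicity of `β` in `gcd(P(α, y), Q(α, y))`. -/
def gcdMultiplicity (P Q : F[X][X]) (α β : AlgebraicClosure F) : ℕ :=
  (EuclideanDomain.gcd (specialize α P) (specialize α Q)).rootMultiplicity β

end Decomposition

end TriDec

end

/-!
The proof is a count of abscissas `α` according to the degree `d(α)` of `gcd(P(α, y), Q(α, y))`.

Over a field, a vector in the kernel of the leading square part of `Sylv_i(P, Q)` is a pair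
`(U, V) ≠ 0` with `deg U < q - i`, `deg V < p - i` and `deg (U * P + V * Q) < i`
(`det_principalSylv_eq_zero_iff`; here `p` and `q` are formal degrees, so that the criterion survives
specialization at `x = α`). If `g` is the gcd, then for `i < deg g` the pair `(Q / g, -P / g)` is
such a relation, while for `i = deg g` there is none as long as `P` or `Q` keeps its degree. Since
the leading coefficients are coprime, one of them does at every `α`. Hence `sres_i(α) = 0` for
`i < d(α)` and `sres_i(α) ≠ 0` for `i = d(α)`, and the roots of `G_i` are exactly the `α` with
`d(α) > i` (`aeval_G_eq_zero_iff`).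

Over a perfect field the squarefree polynomials `G_i` are separable, so their degrees count their
roots and `deg A_i` is the number of `α` with `d(α) = i` (`natDegree_A`). If there is such an `α`,
then `sres_i ≠ 0`, so `B_i` has degree `i` (`natDegree_B`). The degree of the decomposition is
therefore the sum of the `d(α)`, and each `d(α)` is the sum of the multiplicities of the roots of
the gcd above `α`.
-/

namespace TriDec

/-! ### Principal minors of the Sylvester matrix and Bézout relations -/

section PrincipalMatrix

variable {D : Type*} [CommRing D]

/-- The coefficient of the highest possible degree `n - m` comes from the `m`-th column alone, for
which the minor consists of the first `m` columns of `M`. -/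
theorem coeff_polynomialDet {m n : ℕ} (h : m ≤ n) (hm : 0 < m) (M : Matrix (Fin m) (Fin n) D) :
    (polynomialDet h M).coeff (n - m) = (M.submatrix id (Fin.castLE h)).det := by
  have hj : m - 1 < n := by omega
  unfold polynomialDet
  rw [finsetSum_coeff, Finset.sum_eq_single ⟨m - 1, hj⟩]
  · have hnm : n - 1 - (m - 1) = n - m := by omega
    simp only [coeff_C_mul_X_pow, hnm, if_true]
    congr 2
    funext c
    split_ifs with hc
    · rfl
    · ext
      have := c.2
      simp
      omega
  · intro j hjm hne
    have hne' : (j : ℕ) ≠ m - 1 := fun e => hne (Fin.ext e)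
    have := (Finset.mem_filter.1 hjm).2
    rw [coeff_C_mul_X_pow, if_neg]
    omega
  · intro hnot
    exact absurd (Finset.mem_filter.2 ⟨Finset.mem_univ _, by simp; omega⟩) hnot

theorem natDegree_polynomialDet_le {m n : ℕ} (h : m ≤ n) (M : Matrix (Fin m) (Fin n) D) :
    (polynomialDet h M).natDegree ≤ n - m := by
  refine natDegree_sum_le_of_forall_le _ _ fun j hj => ?_
  have := (Finset.mem_filter.1 hj).2
  refine (natDegree_C_mul_X_pow_le _ _).trans ?_
  omega

/-- The square matrix formed by the first `p + q - 2 * i` columns of `Sylv_i(P, Q)`, for formal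
degrees `p` and `q` of `P` and `Q`. Keeping the degrees as parameters lets the matrix commute with
a change of coefficients that lowers the degree of `P` or `Q`. -/
noncomputable def principalSylv (p q i : ℕ) (P Q : D[X]) :
    Matrix (Fin (p + q - 2 * i)) (Fin (p + q - 2 * i)) D :=
  Matrix.of fun r c =>
    (if (r : ℕ) < q - i then X ^ (q - 1 - (r : ℕ)) * P
      else X ^ (p - 1 - ((r : ℕ) - (q - i))) * Q).coeff (p + q - 1 - (c : ℕ))

theorem map_det_principalSylv {E : Type*} [CommRing E] (φ : D →+* E) (p q i : ℕ) (P Q : D[X]) :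
    φ (principalSylv p q i P Q).det = (principalSylv p q i (P.map φ) (Q.map φ)).det := by
  rw [RingHom.map_det]
  congr 1
  ext r c
  simp only [principalSylv, RingHom.mapMatrix_apply, Matrix.map_apply, Matrix.of_apply]
  rw [← coeff_map]
  split_ifs <;> simp

theorem coeff_sylvDet (P Q : D[X]) {i : ℕ} (hiq : i ≤ Q.natDegree)
    (hqp : Q.natDegree ≤ P.natDegree) (h : ¬(i = Q.natDegree ∧ Q.natDegree = P.natDegree)) :
    (sylvDet P Q i).coeff i = (principalSylv P.natDegree Q.natDegree i P Q).det := by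
  have := coeff_polynomialDet (by omega) (by omega) (sylv P Q i)
  rwa [show P.natDegree + Q.natDegree - i - (P.natDegree + Q.natDegree - 2 * i) = i by omega]
    at this

theorem natDegree_sylvDet_le (P Q : D[X]) {i : ℕ} (hiq : i ≤ Q.natDegree)
    (hqp : Q.natDegree ≤ P.natDegree) : (sylvDet P Q i).natDegree ≤ i :=
  (natDegree_polynomialDet_le _ _).trans (by omega)

/-- The vector listing the coefficients of `U` and then those of `V`, from the highest (of index
`q - i - 1`, respectively `p - i - 1`) to the lowest, in the order of the rows of `Sylv_i(P, Q)`. -/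
noncomputable def coeffVec (p q i : ℕ) (U V : D[X]) (r : Fin (p + q - 2 * i)) : D :=
  if (r : ℕ) < q - i then U.coeff (q - i - 1 - r) else V.coeff (p - i - 1 - (r - (q - i)))

theorem sum_C_coeff_reflect {U : D[X]} {n : ℕ} (hU : U.degree < n) :
    ∑ r ∈ Finset.range n, C (U.coeff (n - 1 - r)) * X ^ (n - 1 - r) = U := by
  rw [Finset.sum_range_reflect (fun j => C (U.coeff j) * X ^ j)]
  ext k
  simp only [finsetSum_coeff, coeff_C_mul_X_pow, Finset.sum_ite_eq, Finset.mem_range]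
  split_ifs with hk
  · rfl
  · exact (coeff_eq_zero_of_degree_lt (hU.trans_le (by exact_mod_cast not_lt.1 hk))).symm

/-- The rows of `principalSylv` are the coefficients of multiples of `P` and `Q`, so a combination
of rows is a combination `U * P + V * Q`. -/
theorem vecMul_coeffVec {p q i : ℕ} (hiq : i ≤ q) (hqp : q ≤ p) (P Q : D[X]) {U V : D[X]}
    (hU : U.degree < (q - i : ℕ)) (hV : V.degree < (p - i : ℕ)) (c : Fin (p + q - 2 * i)) :
    Matrix.vecMul (coeffVec p q i U V) (principalSylv p q i P Q) c =
      (U * P + V * Q).coeff (p + q - 1 - i - c) := by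
  have hc := c.2
  have hk : p + q - 1 - (c : ℕ) = (p + q - 1 - i - c) + i := by omega
  have hsum : X ^ i * (U * P + V * Q) = ∑ r ∈ Finset.range (p + q - 2 * i),
      C (if r < q - i then U.coeff (q - i - 1 - r) else V.coeff (p - i - 1 - (r - (q - i)))) *
        (if r < q - i then X ^ (q - 1 - r) * P else X ^ (p - 1 - (r - (q - i))) * Q) := by
    rw [show p + q - 2 * i = (q - i) + (p - i) by omega, Finset.sum_range_add, mul_add]
    congr 1
    · conv_lhs => rw [← sum_C_coeff_reflect hU]
      rw [Finset.sum_mul, Finset.mul_sum]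
      refine Finset.sum_congr rfl fun r hr => ?_
      have hr := Finset.mem_range.1 hr
      rw [if_pos hr, if_pos hr, show q - 1 - r = i + (q - i - 1 - r) by omega, pow_add]
      ring
    · conv_lhs => rw [← sum_C_coeff_reflect hV]
      rw [Finset.sum_mul, Finset.mul_sum]
      refine Finset.sum_congr rfl fun r hr => ?_
      have hr := Finset.mem_range.1 hr
      rw [if_neg (by omega), if_neg (by omega), Nat.add_sub_cancel_left,
        show p - 1 - r = i + (p - i - 1 - r) by omega, pow_add]
      ring
  rw [← coeff_X_pow_mul _ i, ← hk, hsum, finsetSum_coeff, Finset.sum_range]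
  simp only [coeff_C_mul]
  rfl

theorem exists_coeffVec_eq {p q i : ℕ} (v : Fin (p + q - 2 * i) → D) (hiq : i ≤ q) (hqp : q ≤ p) :
    ∃ U V : D[X], U.degree < (q - i : ℕ) ∧ V.degree < (p - i : ℕ) ∧ coeffVec p q i U V = v := by
  -- The values of `v`, extended by zero to all natural numbers.
  let w : ℕ → D := fun r => if h : r < p + q - 2 * i then v ⟨r, h⟩ else 0
  have hdeg : ∀ (n : ℕ) (f : ℕ → D),
      (∑ j ∈ Finset.range n, C (f j) * X ^ j : D[X]).degree < n := fun n f => by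
    refine (degree_sum_le _ _).trans_lt ((Finset.sup_lt_iff (WithBot.bot_lt_coe n)).2 ?_)
    intro j hj
    exact (degree_C_mul_X_pow_le _ _).trans_lt (Nat.cast_lt.2 (Finset.mem_range.1 hj))
  refine ⟨_, _, hdeg (q - i) fun j => w (q - i - 1 - j),
    hdeg (p - i) fun j => w (q - i + (p - i - 1 - j)), ?_⟩
  funext r
  have hr := r.2
  unfold coeffVec
  simp only [finsetSum_coeff, coeff_C_mul_X_pow, Finset.sum_ite_eq, Finset.mem_range]
  split_ifs with h1 h2 h3
  · simp only [w]
    rw [dif_pos (by omega)]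
    congr 1
    ext
    simp
    omega
  · omega
  · simp only [w]
    rw [dif_pos (by omega)]
    congr 1
    ext
    simp
    omega
  · omega

theorem coeffVec_eq_zero_iff {p q i : ℕ} (hiq : i ≤ q) (hqp : q ≤ p) {U V : D[X]}
    (hU : U.degree < (q - i : ℕ)) (hV : V.degree < (p - i : ℕ)) :
    coeffVec p q i U V = 0 ↔ U = 0 ∧ V = 0 := by
  refine ⟨fun h => ⟨?_, ?_⟩, ?_⟩
  · ext k
    by_cases hk : k < q - i
    · have := congrFun h ⟨q - i - 1 - k, by omega⟩
      rw [coeffVec, if_pos (by simp; omega)] at this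
      simpa [show q - i - 1 - (q - i - 1 - k) = k by omega] using this
    · exact coeff_eq_zero_of_degree_lt (hU.trans_le (by exact_mod_cast not_lt.1 hk))
  · ext k
    by_cases hk : k < p - i
    · have := congrFun h ⟨q - i + (p - i - 1 - k), by omega⟩
      rw [coeffVec, if_neg (by simp)] at this
      simpa [show p - i - 1 - (p - i - 1 - k) = k by omega] using this
    · exact coeff_eq_zero_of_degree_lt (hV.trans_le (by exact_mod_cast not_lt.1 hk))
  · rintro ⟨rfl, rfl⟩
    funext r
    simp [coeffVec]

/-- The determinant vanishes if and only if some nontrivial combination `U * P + V * Q` has degree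
less than `i`: the columns of the matrix record its coefficients of index at least `i`. -/
theorem det_principalSylv_eq_zero_iff [IsDomain D] {p q i : ℕ} {P Q : D[X]}
    (hP : P.natDegree ≤ p) (hQ : Q.natDegree ≤ q) (hiq : i ≤ q) (hqp : q ≤ p) :
    (principalSylv p q i P Q).det = 0 ↔ ∃ U V : D[X], U.degree < (q - i : ℕ) ∧
      V.degree < (p - i : ℕ) ∧ ¬(U = 0 ∧ V = 0) ∧ (U * P + V * Q).degree < i := by
  rw [← Matrix.exists_vecMul_eq_zero_iff]
  constructor
  · rintro ⟨v, hv0, hv⟩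
    obtain ⟨U, V, hU, hV, rfl⟩ := exists_coeffVec_eq v hiq hqp
    refine ⟨U, V, hU, hV, fun h => hv0 ((coeffVec_eq_zero_iff hiq hqp hU hV).2 h), ?_⟩
    rw [degree_lt_iff_coeff_zero]
    intro k hk
    by_cases hkn : k < p + q - i
    · have := congrFun hv ⟨p + q - i - 1 - k, by omega⟩
      rw [vecMul_coeffVec hiq hqp P Q hU hV] at this
      simpa [show p + q - 1 - i - (p + q - i - 1 - k) = k by omega] using this
    · -- Both products have degree less than `p + q - i`.
      have hlt : ∀ {W S : D[X]} {a b : ℕ}, W.degree < a → S.natDegree ≤ b → a + b ≤ p + q - i →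
          (W * S).coeff k = 0 := fun {W S a b} hW hS hab => by
        rcases eq_or_ne W 0 with rfl | hW0
        · simp
        refine coeff_eq_zero_of_natDegree_lt (natDegree_mul_le.trans_lt ?_)
        have := (natDegree_lt_iff_degree_lt hW0).2 hW
        omega
      rw [coeff_add, hlt hU hP (by omega), hlt hV hQ (by omega), add_zero]
  · rintro ⟨U, V, hU, hV, h0, hdeg⟩
    refine ⟨_, fun h => h0 ((coeffVec_eq_zero_iff hiq hqp hU hV).1 h), ?_⟩
    funext c
    rw [vecMul_coeffVec hiq hqp P Q hU hV]
    refine coeff_eq_zero_of_degree_lt (hdeg.trans_le ?_)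
    have := c.2
    exact_mod_cast (by omega : i ≤ p + q - 1 - i - c)

end PrincipalMatrix

/-! ### Principal minors and the degree of the gcd over a field -/

section GcdDegree

variable {K : Type*} [Field K]

/-- The cofactor of a divisor of degree greater than `m` has degree less than `n - m`. -/
theorem degree_lt_of_mul_eq {g A R : K[X]} {n m : ℕ} (h : R = g * A) (hR : R.natDegree ≤ n)
    (hg : g ≠ 0) (hm : m < g.natDegree) : A.degree < (n - m : ℕ) := by
  rcases eq_or_ne A 0 with rfl | hA
  · simp
  rw [← natDegree_lt_iff_degree_lt hA]
  have := natDegree_mul hg hA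
  rw [← h] at this
  omega

variable [DecidableEq K[X]]

/-- Below the degree of the gcd `g` the determinant vanishes: the cofactors `P / g` and `Q / g`
give a relation. -/
theorem det_principalSylv_eq_zero_of_lt {p q i : ℕ} {P Q : K[X]} (hP : P.natDegree ≤ p)
    (hQ : Q.natDegree ≤ q) (hqp : q ≤ p) (h0 : ¬(P = 0 ∧ Q = 0))
    (hd : (EuclideanDomain.gcd P Q).natDegree ≤ q)
    (hi : i < (EuclideanDomain.gcd P Q).natDegree) : (principalSylv p q i P Q).det = 0 := by
  have hg : EuclideanDomain.gcd P Q ≠ 0 := fun h => h0 (EuclideanDomain.gcd_eq_zero_iff.1 h)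
  obtain ⟨A, hA⟩ := EuclideanDomain.gcd_dvd_left P Q
  obtain ⟨B, hB⟩ := EuclideanDomain.gcd_dvd_right P Q
  generalize EuclideanDomain.gcd P Q = g at *
  rw [det_principalSylv_eq_zero_iff hP hQ (by omega) hqp]
  refine ⟨B, -A, degree_lt_of_mul_eq hB hQ hg hi, ?_, ?_, ?_⟩
  · rw [degree_neg]
    exact degree_lt_of_mul_eq hA hP hg hi
  · rintro ⟨rfl, h⟩
    rw [neg_eq_zero] at h
    subst h
    exact h0 ⟨by simpa using hA, by simpa using hB⟩
  · rw [hA, hB, show B * (g * A) + -A * (g * B) = 0 by ring, degree_zero]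
    exact WithBot.bot_lt_coe _

/-- At the degree of the gcd `g` the determinant is nonzero, as soon as one of the two formal
degrees is the true one: a combination `U * P + V * Q` of degree less than `deg g` is zero, and then
the coprime cofactors `P / g` and `Q / g` divide `V` and `U`. -/
theorem det_principalSylv_ne_zero {p q : ℕ} {P Q : K[X]} (hP : P.natDegree ≤ p)
    (hQ : Q.natDegree ≤ q) (hqp : q ≤ p)
    (hfull : (P ≠ 0 ∧ P.natDegree = p) ∨ (Q ≠ 0 ∧ Q.natDegree = q))
    (hd : (EuclideanDomain.gcd P Q).natDegree ≤ q) :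
    (principalSylv p q (EuclideanDomain.gcd P Q).natDegree P Q).det ≠ 0 := by
  have h0 : ¬(P = 0 ∧ Q = 0) := by rintro ⟨h, h'⟩; tauto
  have hg : EuclideanDomain.gcd P Q ≠ 0 := fun h => h0 (EuclideanDomain.gcd_eq_zero_iff.1 h)
  obtain ⟨A, hA⟩ := EuclideanDomain.gcd_dvd_left P Q
  obtain ⟨B, hB⟩ := EuclideanDomain.gcd_dvd_right P Q
  have hbez := EuclideanDomain.gcd_eq_gcd_ab P Q
  generalize EuclideanDomain.gcd P Q = g at *
  rw [Ne, det_principalSylv_eq_zero_iff hP hQ hd hqp]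
  rintro ⟨U, V, hU, hV, hUV, hdeg⟩
  have hrel : U * P + V * Q = 0 := by
    refine eq_zero_of_dvd_of_degree_lt (p := g) ?_ ?_
    · exact dvd_add (hA ▸ (dvd_mul_right g A).mul_left U) (hB ▸ (dvd_mul_right g B).mul_left V)
    · rwa [degree_eq_natDegree hg]
  have hrel' : U * A = -(V * B) := by
    refine mul_left_cancel₀ hg ?_
    rw [hA, hB] at hrel
    linear_combination hrel
  have hcop : IsCoprime A B := by
    refine ⟨EuclideanDomain.gcdA P Q, EuclideanDomain.gcdB P Q, mul_left_cancel₀ hg ?_⟩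
    linear_combination -EuclideanDomain.gcdA P Q * hA - EuclideanDomain.gcdB P Q * hB - hbez
  -- A multiple of a cofactor of full degree is zero if it obeys the bound on `U` or `V`.
  have key : ∀ {S T R : K[X]} {n : ℕ}, S ∣ T → R = g * S → R ≠ 0 → R.natDegree = n →
      T.degree < (n - g.natDegree : ℕ) → T = 0 := by
    intro S T R n hST hR hR0 hn hT
    refine eq_zero_of_dvd_of_degree_lt hST (hT.trans_le ?_)
    have hS0 : S ≠ 0 := by rintro rfl; simp [hR] at hR0
    have := natDegree_mul hg hS0
    rw [← hR, hn] at this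
    rw [degree_eq_natDegree hS0, this, Nat.add_sub_cancel_left]
  rcases hfull with ⟨hP0, hPp⟩ | ⟨hQ0, hQq⟩
  · have hdvd : A ∣ V := hcop.dvd_of_dvd_mul_right ((dvd_neg.1 (hrel' ▸ dvd_mul_left A U)))
    have hV0 := key hdvd hA hP0 hPp hV
    refine hUV ⟨?_, hV0⟩
    simpa [hV0, hP0] using hrel
  · have hdvd : B ∣ U := hcop.symm.dvd_of_dvd_mul_right
      (hrel' ▸ dvd_neg.2 (dvd_mul_left B V))
    have hU0 := key hdvd hB hQ0 hQq hU
    refine hUV ⟨hU0, ?_⟩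
    simpa [hU0, hQ0] using hrel

end GcdDegree

/-! ### Specialization of the first variable -/

section Specialization

variable {F : Type*} [Field F] {P Q : F[X][X]}

theorem natDegree_specialize_le (α : AlgebraicClosure F) (P : F[X][X]) :
    (specialize α P).natDegree ≤ P.natDegree :=
  natDegree_map_le

theorem specialize_ne_zero_of_aeval_leadingCoeff_ne_zero {α : AlgebraicClosure F}
    (h : aeval α P.leadingCoeff ≠ 0) :
    specialize α P ≠ 0 ∧ (specialize α P).natDegree = P.natDegree := by
  refine ⟨fun h0 => h ?_, natDegree_map_of_leadingCoeff_ne_zero _ h⟩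
  have := congrArg (fun f => f.coeff P.natDegree) h0
  simpa [specialize, coeff_map] using this

/-- As the leading coefficients are coprime, they do not vanish at the same `α`, so one of the two
polynomials keeps its degree. -/
theorem specialize_natDegree_eq_or (hlc : IsCoprime P.leadingCoeff Q.leadingCoeff)
    (α : AlgebraicClosure F) :
    (specialize α P ≠ 0 ∧ (specialize α P).natDegree = P.natDegree) ∨
      (specialize α Q ≠ 0 ∧ (specialize α Q).natDegree = Q.natDegree) := by
  obtain ⟨a, b, hab⟩ := hlc
  by_cases hP : aeval α P.leadingCoeff = 0
  · refine Or.inr (specialize_ne_zero_of_aeval_leadingCoeff_ne_zero fun hQ => ?_)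
    have := congrArg (aeval α) hab
    simp [hP, hQ] at this
  · exact Or.inl (specialize_ne_zero_of_aeval_leadingCoeff_ne_zero hP)

theorem aeval_principalSubresultant (hdeg : Q.natDegree ≤ P.natDegree) {i : ℕ}
    (hi : i ≤ Q.natDegree) (h : ¬(i = Q.natDegree ∧ Q.natDegree = P.natDegree))
    (α : AlgebraicClosure F) :
    aeval α (principalSubresultant P Q i) =
      (principalSylv P.natDegree Q.natDegree i (specialize α P) (specialize α Q)).det := by
  rw [principalSubresultant, if_neg h, coeff_sylvDet P Q hi hdeg h]
  exact map_det_principalSylv (aeval α : F[X] →ₐ[F] AlgebraicClosure F).toRingHom _ _ _ _ _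

open scoped Classical in
/-- The degree of `gcd(P(α, y), Q(α, y))`. -/
noncomputable def gcdDegree (P Q : F[X][X]) (α : AlgebraicClosure F) : ℕ :=
  (EuclideanDomain.gcd (specialize α P) (specialize α Q)).natDegree

section CoprimeLeadingCoeff

variable (hlc : IsCoprime P.leadingCoeff Q.leadingCoeff) (hdeg : Q.natDegree ≤ P.natDegree)
  (hQ : Q.natDegree < P.natDegree → ∀ α : AlgebraicClosure F, specialize α Q ≠ 0)

include hlc

theorem gcd_specialize_ne_zero [DecidableEq (AlgebraicClosure F)[X]] (α : AlgebraicClosure F) :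
    EuclideanDomain.gcd (specialize α P) (specialize α Q) ≠ 0 := by
  intro h
  obtain ⟨h1, h2⟩ := EuclideanDomain.gcd_eq_zero_iff.1 h
  exact (specialize_natDegree_eq_or hlc α).elim (fun h => h.1 h1) (fun h => h.1 h2)

include hdeg hQ

/-- When `deg Q < deg P`, this needs `Q(α, y) ≠ 0`, since the gcd would otherwise be `P(α, y)`. -/
theorem gcdDegree_le (α : AlgebraicClosure F) : gcdDegree P Q α ≤ Q.natDegree := by
  classical
  have hleQ : specialize α Q ≠ 0 → gcdDegree P Q α ≤ Q.natDegree := fun h =>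
    (natDegree_le_of_dvd (EuclideanDomain.gcd_dvd_right _ _) h).trans (natDegree_specialize_le α Q)
  rcases hdeg.lt_or_eq with hlt | heq
  · exact hleQ (hQ hlt α)
  · rcases specialize_natDegree_eq_or hlc α with h | h
    · rw [heq]
      exact (natDegree_le_of_dvd (EuclideanDomain.gcd_dvd_left _ _) h.1).trans h.2.le
    · exact hleQ h.1

theorem aeval_principalSubresultant_eq_zero {α : AlgebraicClosure F} {i : ℕ}
    (hi : i < gcdDegree P Q α) : aeval α (principalSubresultant P Q i) = 0 := by
  classical
  have hd := gcdDegree_le hlc hdeg hQ α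
  rw [aeval_principalSubresultant hdeg (by omega) (by omega)]
  refine det_principalSylv_eq_zero_of_lt (natDegree_specialize_le α P)
    (natDegree_specialize_le α Q) hdeg ?_ hd hi
  rintro ⟨h1, h2⟩
  exact gcd_specialize_ne_zero hlc α (EuclideanDomain.gcd_eq_zero_iff.2 ⟨h1, h2⟩)

/-- Together with `aeval_principalSubresultant_eq_zero`: the degree of the gcd at `α` is the first
index at which the principal subresultant coefficient does not vanish. -/
theorem aeval_principalSubresultant_gcdDegree_ne_zero (α : AlgebraicClosure F) :
    aeval α (principalSubresultant P Q (gcdDegree P Q α)) ≠ 0 := by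
  classical
  have hd := gcdDegree_le hlc hdeg hQ α
  by_cases h : gcdDegree P Q α = Q.natDegree ∧ Q.natDegree = P.natDegree
  · rw [principalSubresultant, if_pos h]
    simp
  · rw [aeval_principalSubresultant hdeg hd h]
    exact det_principalSylv_ne_zero (natDegree_specialize_le α P)
      (natDegree_specialize_le α Q) hdeg (specialize_natDegree_eq_or hlc α) hd

end CoprimeLeadingCoeff

/-- The resultant of relatively prime polynomials is nonzero: in a relation `U * P + V * Q = 0`,
the polynomial `P` divides `V`, whose degree is too small. -/
theorem principalSubresultant_zero_ne_zero (hPQ : IsRelPrime P Q)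
    (hdeg : Q.natDegree ≤ P.natDegree) : principalSubresultant P Q 0 ≠ 0 := by
  by_cases h : 0 = Q.natDegree ∧ Q.natDegree = P.natDegree
  · rw [principalSubresultant, if_pos h]
    exact one_ne_zero
  rw [principalSubresultant, if_neg h, coeff_sylvDet P Q (Nat.zero_le _) hdeg h, Ne,
    det_principalSylv_eq_zero_iff le_rfl le_rfl (Nat.zero_le _) hdeg]
  rintro ⟨U, V, -, hV, hUV, hrel⟩
  -- `P = 0` would force both degrees to be zero, which is the case excluded by `h`.
  have hP0 : P ≠ 0 := by
    rintro rfl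
    simp at hdeg
    simp [hdeg] at h
  have hrel0 : U * P + V * Q = 0 := by
    simpa using hrel
  have hdvd : P ∣ V := hPQ.dvd_of_dvd_mul_right
    ⟨-U, by linear_combination hrel0⟩
  have hV0 : V = 0 := eq_zero_of_dvd_of_degree_lt hdvd (by
    rwa [degree_eq_natDegree hP0])
  refine hUV ⟨?_, hV0⟩
  simpa [hV0, hP0] using hrel0

end Specialization

/-! ### Degrees of the triangular decomposition as counts of abscissas -/

section Counting

variable {F : Type*} [Field F] {P Q : F[X][X]}

theorem G_succ_dvd (P Q : F[X][X]) (i : ℕ) : G P Q (i + 1) ∣ G P Q i := by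
  classical
  exact EuclideanDomain.gcd_dvd_left _ _

theorem squarefree_G (P Q : F[X][X]) : ∀ i, Squarefree (G P Q i)
  | 0 => by
    classical
    exact UniqueFactorizationMonoid.squarefree_radical
  | i + 1 => (squarefree_G P Q i).squarefree_of_dvd (G_succ_dvd P Q i)

theorem G_ne_zero (P Q : F[X][X]) (i : ℕ) : G P Q i ≠ 0 :=
  (squarefree_G P Q i).ne_zero

theorem aeval_radical_eq_zero_iff [NormalizationMonoid F[X]] {f : F[X]} (hf : f ≠ 0)
    (α : AlgebraicClosure F) :
    aeval α (UniqueFactorizationMonoid.radical f) = 0 ↔ aeval α f = 0 := by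
  constructor
  · exact aeval_eq_zero_of_dvd_aeval_eq_zero UniqueFactorizationMonoid.radical_dvd_self
  · intro h
    obtain ⟨n, hn⟩ := UniqueFactorizationMonoid.exists_dvd_radical_self_pow hf
    have := aeval_eq_zero_of_dvd_aeval_eq_zero hn h
    rw [map_pow] at this
    exact eq_zero_of_pow_eq_zero this

theorem aeval_gcd_eq_zero_iff {K : Type*} [CommRing K] [Algebra F K] [DecidableEq F[X]]
    (f g : F[X]) (α : K) :
    aeval α (EuclideanDomain.gcd f g) = 0 ↔ aeval α f = 0 ∧ aeval α g = 0 := by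
  constructor
  · exact fun h => ⟨aeval_eq_zero_of_dvd_aeval_eq_zero (EuclideanDomain.gcd_dvd_left f g) h,
      aeval_eq_zero_of_dvd_aeval_eq_zero (EuclideanDomain.gcd_dvd_right f g) h⟩
  · rintro ⟨hf, hg⟩
    rw [EuclideanDomain.gcd_eq_gcd_ab]
    simp [hf, hg]

theorem card_toFinset_aroots [PerfectField F] [DecidableEq (AlgebraicClosure F)] {f : F[X]}
    (hf : Squarefree f) : (f.aroots (AlgebraicClosure F)).toFinset.card = f.natDegree := by
  rw [Multiset.toFinset_card_of_nodup
      (nodup_roots (PerfectField.separable_iff_squarefree.2 hf).map),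
    IsAlgClosed.card_roots_eq_natDegree, natDegree_map]

variable (hPQ : IsRelPrime P Q) (hlc : IsCoprime P.leadingCoeff Q.leadingCoeff)
  (hdeg : Q.natDegree ≤ P.natDegree)
  (hQ : Q.natDegree < P.natDegree → ∀ α : AlgebraicClosure F, specialize α Q ≠ 0)

include hPQ hlc hdeg hQ

/-- `G_i` selects the abscissas above which the gcd has degree larger than `i`. -/
theorem aeval_G_eq_zero_iff (α : AlgebraicClosure F) (i : ℕ) :
    aeval α (G P Q i) = 0 ↔ i < gcdDegree P Q α := by
  classical
  have hne := aeval_principalSubresultant_gcdDegree_ne_zero hlc hdeg hQ α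
  have hstep : ∀ i, i ≤ gcdDegree P Q α →
      (aeval α (principalSubresultant P Q i) = 0 ↔ i < gcdDegree P Q α) := fun i hi =>
    ⟨fun h => hi.lt_of_ne fun e => hne (e ▸ h),
      aeval_principalSubresultant_eq_zero hlc hdeg hQ⟩
  induction i with
  | zero =>
    rw [G, aeval_radical_eq_zero_iff (principalSubresultant_zero_ne_zero hPQ hdeg),
      hstep 0 (Nat.zero_le _)]
  | succ i ih =>
    rw [G, aeval_gcd_eq_zero_iff]
    refine (and_congr_left' ih).trans ?_
    exact ⟨fun h => (hstep _ h.1).1 h.2, fun h => ⟨by omega, (hstep _ h.le).2 h⟩⟩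

theorem mem_aroots_G_iff (α : AlgebraicClosure F) (i : ℕ) :
    α ∈ (G P Q i).aroots (AlgebraicClosure F) ↔ i < gcdDegree P Q α := by
  rw [mem_aroots, aeval_G_eq_zero_iff hPQ hlc hdeg hQ]
  exact and_iff_right (G_ne_zero P Q i)

/-- `A_i` is separable, with the `α` such that `i - 1 < d(α)` but not `i < d(α)` as roots. -/
theorem natDegree_A [PerfectField F] [DecidableEq (AlgebraicClosure F)] {i : ℕ} (hi : 1 ≤ i) :
    (A P Q i).natDegree =
      (((G P Q 0).aroots (AlgebraicClosure F)).toFinset.filter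
        fun α => gcdDegree P Q α = i).card := by
  obtain ⟨j, rfl⟩ : ∃ j, i = j + 1 := ⟨i - 1, by omega⟩
  have hmul : A P Q (j + 1) * G P Q (j + 1) = G P Q j :=
    (mul_comm _ _).trans <| EuclideanDomain.mul_div_cancel' (G_ne_zero P Q _) (G_succ_dvd P Q j)
  have hA0 : A P Q (j + 1) ≠ 0 := fun h => G_ne_zero P Q j (by rw [← hmul, h, zero_mul])
  have hnat := natDegree_mul hA0 (G_ne_zero P Q (j + 1))
  rw [hmul, ← card_toFinset_aroots (squarefree_G P Q j),
    ← card_toFinset_aroots (squarefree_G P Q (j + 1))] at hnat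
  -- The roots of `G_j` are the `α` with `d(α) = j + 1` together with the roots of `G_(j+1)`.
  rw [← Nat.add_right_cancel_iff, ← hnat, ← Finset.card_union_of_disjoint]
  · congr 1
    ext α
    simp only [Finset.mem_union, Finset.mem_filter, Multiset.mem_toFinset,
      mem_aroots_G_iff hPQ hlc hdeg hQ]
    omega
  · rw [Finset.disjoint_left]
    intro α
    simp only [Finset.mem_filter, Multiset.mem_toFinset, mem_aroots_G_iff hPQ hlc hdeg hQ]
    omega

/-- A root `α` of `A_i` certifies that `sres_i`, the coefficient of `y^i` in `Sres_i`, is not the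
zero polynomial. -/
theorem natDegree_B [PerfectField F] {i : ℕ} (hi : 1 ≤ i) (hiq : i ≤ Q.natDegree)
    (hA : 0 < (A P Q i).natDegree) : (B P Q i).natDegree = i := by
  classical
  rw [natDegree_A hPQ hlc hdeg hQ hi, Finset.card_pos] at hA
  obtain ⟨α, hα⟩ := hA
  have hd := (Finset.mem_filter.1 hα).2
  have hne : principalSubresultant P Q i ≠ 0 := by
    intro h
    apply aeval_principalSubresultant_gcdDegree_ne_zero hlc hdeg hQ α
    rw [hd, h, map_zero]
  unfold B subresultant
  unfold principalSubresultant at hne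
  split_ifs at hne ⊢ with h
  · have hQ0 : Q ≠ 0 := by
      rintro rfl
      simp at hiq
      omega
    rw [natDegree_C_mul (by simpa using hQ0),
      natDegree_map_eq_of_injective (IsFractionRing.injective _ _)]
    exact h.1.symm
  · rw [natDegree_map_eq_of_injective (IsFractionRing.injective _ _)]
    exact le_antisymm (natDegree_sylvDet_le P Q hiq hdeg) (le_natDegree_of_ne_zero hne)

theorem degree_eq_sum_gcdDegree [PerfectField F] [DecidableEq (AlgebraicClosure F)] :
    degree P Q =
      ∑ α ∈ ((G P Q 0).aroots (AlgebraicClosure F)).toFinset, gcdDegree P Q α := by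
  have hmaps : ∀ α ∈ ((G P Q 0).aroots (AlgebraicClosure F)).toFinset,
      gcdDegree P Q α ∈ Finset.Icc 1 Q.natDegree := fun α hα => by
    rw [Multiset.mem_toFinset, mem_aroots_G_iff hPQ hlc hdeg hQ] at hα
    exact Finset.mem_Icc.2 ⟨hα, gcdDegree_le hlc hdeg hQ α⟩
  rw [← Finset.sum_fiberwise_of_maps_to' hmaps (fun d => d), degree, indexSet,
    Finset.sum_filter]
  refine Finset.sum_congr rfl fun i hi => ?_
  obtain ⟨hi1, hiq⟩ := Finset.mem_Icc.1 hi
  rw [Finset.sum_const, smul_eq_mul, ← natDegree_A hPQ hlc hdeg hQ hi1]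
  split_ifs with h
  · rw [natDegree_B hPQ hlc hdeg hQ hi1 hiq h]
  · rw [Nat.eq_zero_of_not_pos h, zero_mul]

omit hPQ hdeg hQ in
theorem mem_solutions_iff [DecidableEq (AlgebraicClosure F)[X]]
    (z : AlgebraicClosure F × AlgebraicClosure F) :
    z ∈ solutions P Q ↔
      z.2 ∈ (EuclideanDomain.gcd (specialize z.1 P) (specialize z.1 Q)).roots := by
  rw [mem_roots (gcd_specialize_ne_zero hlc z.1)]
  exact (aeval_gcd_eq_zero_iff _ _ z.2).symm

end Counting

end TriDec

theorem mainTheorem8 {F : Type*} [Field F] [PerfectField F] (P Q : Polynomial (Polynomial F))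
    (hPQ : IsRelPrime P Q) (hlc : IsCoprime P.leadingCoeff Q.leadingCoeff)
    (hdeg : Q.natDegree ≤ P.natDegree)
    (hQ : Q.natDegree < P.natDegree →
      ∀ α : AlgebraicClosure F, TriDec.specialize α Q ≠ 0) :
    (TriDec.solutions P Q).Finite ∧
      TriDec.degree P Q =
        ∑ᶠ z ∈ TriDec.solutions P Q, TriDec.gcdMultiplicity P Q z.1 z.2 := by
  classical
  let g : AlgebraicClosure F → (AlgebraicClosure F)[X] := fun α =>
    EuclideanDomain.gcd (TriDec.specialize α P) (TriDec.specialize α Q)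
  let S : Finset (AlgebraicClosure F) :=
    ((TriDec.G P Q 0).aroots (AlgebraicClosure F)).toFinset
  let T : Finset (AlgebraicClosure F × AlgebraicClosure F) :=
    S.biUnion fun α => (g α).roots.toFinset.image fun β => (α, β)
  have hT : ∀ z : AlgebraicClosure F × AlgebraicClosure F,
      z ∈ T ↔ z.1 ∈ S ∧ z.2 ∈ (g z.1).roots.toFinset := by
    rintro ⟨α, β⟩
    simp [T]
  -- A common root above `α` makes the gcd nonconstant, so that `α` is a root of the resultant.
  have hS : ∀ α β, β ∈ (g α).roots → α ∈ S := fun α β hβ => by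
    rw [Multiset.mem_toFinset, TriDec.mem_aroots_G_iff hPQ hlc hdeg hQ]
    exact (Multiset.card_pos_iff_exists_mem.2 ⟨β, hβ⟩).trans_le (card_roots' _)
  have hsol : TriDec.solutions P Q = T := by
    ext z
    rw [Finset.mem_coe, hT, Multiset.mem_toFinset (a := z.2), TriDec.mem_solutions_iff hlc]
    exact ⟨fun h => ⟨hS _ _ h, h⟩, And.right⟩
  refine ⟨hsol ▸ T.finite_toSet, ?_⟩
  rw [hsol, finsum_mem_coe_finset, Finset.sum_finset_product T S (fun α => (g α).roots.toFinset) hT,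
    TriDec.degree_eq_sum_gcdDegree hPQ hlc hdeg hQ]
  refine Finset.sum_congr rfl fun α _ => ?_
  calc TriDec.gcdDegree P Q α = Multiset.card (g α).roots :=
        IsAlgClosed.card_roots_eq_natDegree.symm
    _ = ∑ β ∈ (g α).roots.toFinset, (g α).roots.count β :=
        (Multiset.toFinset_sum_count_eq _).symm
    _ = ∑ β ∈ (g α).roots.toFinset, TriDec.gcdMultiplicity P Q α β :=
        Finset.sum_congr rfl fun β _ => count_roots _
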